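/- For $n\ge 2$ let $D_n$ be the lattice identity (an inequality $P\le Q$ abbreviating $P\wedge Q=P$) in the $2n$ variables $a_1,\dots,a_n,b_1,\dots,b_n$ $$ a_n \wedge \Bigl( \Bigl[ \bigwedge_{i=1}^{n-1} (a_i \vee b_i) \Bigr] \vee b_n \Bigr) \;\le\; a_1 \vee \Bigl( \Bigl[ \bigvee_{i=1}^{n-1} \bigl((a_i \vee a_{i+1}) \wedge (b_i \vee b_{i+1})\bigr) \Bigr] \wedge (b_1 \vee b_n) \Bigr). $$ The identities $D_3, D_7, D_{15},\dots$, that is, $D_{2^n-1}$ for $n\ge 2$, form an infinite sequence of identities of strictly increasing strength, already on the class of finite lattices: for all integers $2\le m<n$, 1. every lattice (finite or not) that satisfies $D_{2^n-1}$ satisfies $D_{2^m-1}$, and 2. there is a finite lattice that satisfies $D_{2^m-1}$ but not $D_{2^n-1}$. The sequence begins with $D_3$, which is the Arguesian law: a lattice satisfies $D_3$ if and only if it is Arguesian, i.e. for all its elements $a_0,a_1,a_2,b_0,b_1,b_2$ $$ (a_0 \vee b_0) \wedge (a_1 \vee b_1) \wedge (a_2 \vee b_2) \le (a_0 \wedge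 (y \vee a_1)) \vee (b_0 \wedge (y \vee b_1)), $$ where $y = (a_0 \vee a_1) \wedge(b_0 \vee b_1) \wedge [((a_0 \vee a_2) \wedge (b_0 \vee b_2)) \vee ((a_1 \vee a_2) \wedge (b_1 \vee b_2))]$. -/

import Mathlib

universe u

/-- The `n`-th order Arguesian law `D_n`, `n ≥ 2`, in the `2 n` variables
`a 1, …, a n, b 1, …, b n`:
`a_n ⊓ (⨅_{i=1}^{n-1} (a_i ⊔ b_i) ⊔ b_n) ≤
  a_1 ⊔ ((⨆_{i=1}^{n-1} (a_i ⊔ a_{i+1}) ⊓ (b_i ⊔ b_{i+1})) ⊓ (b_1 ⊔ b_n))`.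
The iterated meet and join are over the nonempty index set `{1, …, n-1}`, so no top or bottom
element is needed. Values of `a` and `b` outside `{1, …, n}` do not occur.
For `n ≤ 1` the law is trivially true (the index set is empty, and `a_1 ⊓ _ ≤ a_1 ⊔ _`). -/
def HigherArguesian (n : ℕ) (L : Type*) [Lattice L] : Prop :=
  ∀ (hn : 2 ≤ n) (a b : ℕ → L),
    have hne : (Finset.Icc 1 (n - 1)).Nonempty := Finset.nonempty_Icc.mpr (Nat.le_sub_one_of_lt hn)
    a n ⊓ ((Finset.Icc 1 (n - 1)).inf' hne (fun i => a i ⊔ b i) ⊔ b n) ≤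
      a 1 ⊔ ((Finset.Icc 1 (n - 1)).sup' hne (fun i => (a i ⊔ a (i + 1)) ⊓ (b i ⊔ b (i + 1))) ⊓
        (b 1 ⊔ b n))

/-- Arguesian lattices, by Jónsson's identity. -/
def Arguesian (L : Type*) [Lattice L] : Prop :=
  ∀ a₀ a₁ a₂ b₀ b₁ b₂ : L,
    let y := (a₀ ⊔ a₁) ⊓ (b₀ ⊔ b₁) ⊓ (((a₀ ⊔ a₂) ⊓ (b₀ ⊔ b₂)) ⊔ ((a₁ ⊔ a₂) ⊓ (b₁ ⊔ b₂)))
    (a₀ ⊔ b₀) ⊓ (a₁ ⊔ b₁) ⊓ (a₂ ⊔ b₂) ≤ (a₀ ⊓ (y ⊔ a₁)) ⊔ (b₀ ⊓ (y ⊔ b₁))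

/-!
The law `D_n` with larger index implies the ones with smaller index by repeating the first pair of
variables, since each `D_n` implies modularity (`HigherArguesian.mono`). For `n = 3` the law and
Jónsson's Arguesian identity imply each other by short computations in modular lattices.

For the separation, let `n` be odd. Following Haiman, a finite lattice is constructed in which `D_n`
fails, while any fewer than `n` of its elements lie in a sublattice embeddable in the lattice of
subspaces of a vector space. Subspace lattices satisfy all laws
(`Submodule.higherArguesian`), so every `D_m` with `2 * m < n` holds in this lattice; and
`2 * (2 ^ m - 1) < 2 ^ n - 1` for `m < n`.

Let `K` be a finite field of characteristic other than `2` and `V = P × A` with `P = A = K ^ n`,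
indices being taken modulo `n`; let `f j` be the coordinate functions of `P` and `α j` the basis of
`A`. Take the subspaces in `P`, the subspaces containing `P`, and those in the intervals
`[{f j = f (j + 1) = 0}, P + ⟨α j⟩]` (sides) and `[{f j = 0}, P + ⟨α (j - 1), α j⟩]` (corners).
These form a sublattice of the subspace lattice, in which sides and corners make up a closed chain.
The chain is now twisted: at each corner, the part in `P + ⟨α j⟩` is replaced by its image under
`(p, a) ↦ (p, -a)`. The resulting subsets of `V` (`TwistedPolygon.IsTwisted`) are still closed under
intersection (`IsTwisted.inter`), hence form a lattice.

- If the side and the corner at one index `i` are left out, the chain is open, and a change of signs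
  on `A` which depends only on the direction (`straighten`) undoes the twist. The remaining elements
  form a sublattice isomorphic to a lattice of subspaces (`linearPartHom`). An element is outside
  `linearPart i` for at most one `i`.
- Around the whole chain the signs multiply to `(-1) ^ n = -1`, which is what makes `D_n` fail, with
  `a j` and `b j` the subspaces of `P + ⟨α j⟩` where `f j` and `f (j + 1)` both vanish, respectively
  both equal the coordinate at `α j` (`not_higherArguesian_twisted`).
-/

/-! ### Higher Arguesian laws in arbitrary lattices -/

section Lattices

variable {L : Type*} [Lattice L]

theorem HigherArguesian.isModularLattice {n : ℕ} (hn : 2 ≤ n) (h : HigherArguesian n L) :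
    IsModularLattice L where
  sup_inf_le_assoc_of_le {x} y {z} hxz := by
    have key := h hn (fun i => if i = n then z else x) (fun _ => y)
    have hne : (Finset.Icc 1 (n - 1)).Nonempty :=
      Finset.nonempty_Icc.mpr (Nat.le_sub_one_of_lt hn)
    have h1 : (1 : ℕ) ≠ n := by omega
    simp only [if_true, if_neg h1] at key
    have hl : z ⊓ (x ⊔ y) ≤ z ⊓ ((Finset.Icc 1 (n - 1)).inf' hne
        (fun i => (if i = n then z else x) ⊔ y) ⊔ y) := by
      refine inf_le_inf_left _ (le_trans ?_ le_sup_left)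
      refine Finset.le_inf' _ _ fun i hi => ?_
      have : i ≠ n := by have := Finset.mem_Icc.mp hi; omega
      simp [this]
    have hr : (Finset.Icc 1 (n - 1)).sup' hne (fun i => ((if i = n then z else x) ⊔
        (if i + 1 = n then z else x)) ⊓ (y ⊔ y)) ≤ z ⊓ y := by
      refine Finset.sup'_le _ _ fun i _ => ?_
      refine inf_le_inf (sup_le ?_ ?_) (sup_idem y).le <;> split_ifs <;> simp [hxz]
    calc (x ⊔ y) ⊓ z = z ⊓ (x ⊔ y) := inf_comm _ _
      _ ≤ _ := hl
      _ ≤ _ := key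
      _ ≤ x ⊔ y ⊓ z := by
        refine sup_le_sup_left (le_trans inf_le_left (le_trans hr (inf_comm _ _).le)) _

/-- The higher Arguesian laws get stronger with the index: repeat `a 1` and `b 1`. The repetition
adds terms `a 1 ⊓ b 1` to the join on the right, which modularity moves into `a 1`. -/
theorem HigherArguesian.mono {m n : ℕ} (hmn : m ≤ n) (h : HigherArguesian n L) :
    HigherArguesian m L := by
  intro hm a b hne
  have hn : 2 ≤ n := hm.trans hmn
  have := h.isModularLattice hn
  have hne' : (Finset.Icc 1 (n - 1)).Nonempty :=
    Finset.nonempty_Icc.mpr (Nat.le_sub_one_of_lt hn)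
  have key := h hn (fun i => a (max 1 (i - (n - m)))) (fun i => b (max 1 (i - (n - m))))
  have e1 : max 1 (n - (n - m)) = m := by omega
  have e2 : max 1 (1 - (n - m)) = 1 := by omega
  simp only [e1, e2] at key
  set X := (Finset.Icc 1 (m - 1)).sup' hne (fun i => (a i ⊔ a (i + 1)) ⊓ (b i ⊔ b (i + 1)))
  refine le_trans (inf_le_inf_left _ (sup_le_sup_right ?_ _)) (key.trans ?_)
  · refine Finset.le_inf' _ _ fun i hi => ?_
    have hi := Finset.mem_Icc.mp hi
    exact Finset.inf'_le (fun i => a i ⊔ b i) (Finset.mem_Icc.mpr (by omega))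
  · have hsup : (Finset.Icc 1 (n - 1)).sup' hne' (fun i =>
        (a (max 1 (i - (n - m))) ⊔ a (max 1 (i + 1 - (n - m)))) ⊓
          (b (max 1 (i - (n - m))) ⊔ b (max 1 (i + 1 - (n - m))))) ≤ (a 1 ⊓ b 1) ⊔ X := by
      refine Finset.sup'_le _ _ fun i hi => ?_
      have hi := Finset.mem_Icc.mp hi
      rcases Nat.lt_or_ge (n - m) i with hlt | hge
      · refine le_sup_of_le_right ?_
        have e3 : max 1 (i - (n - m)) = i - (n - m) := by omega
        have e4 : max 1 (i + 1 - (n - m)) = i - (n - m) + 1 := by omega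
        rw [e3, e4]
        exact Finset.le_sup' (fun i => (a i ⊔ a (i + 1)) ⊓ (b i ⊔ b (i + 1)))
          (Finset.mem_Icc.mpr (by omega))
      · have e3 : max 1 (i - (n - m)) = 1 := by omega
        have e4 : max 1 (i + 1 - (n - m)) = 1 := by omega
        simp [e3, e4]
    refine sup_le le_sup_left (le_trans (inf_le_inf_right _ hsup) ?_)
    rw [sup_inf_assoc_of_le X (inf_le_right.trans le_sup_left : a 1 ⊓ b 1 ≤ b 1 ⊔ b m)]
    exact sup_le_sup_right inf_le_left _

theorem Arguesian.isModularLattice (h : Arguesian L) : IsModularLattice L where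
  sup_inf_le_assoc_of_le {x} y {z} hxz := by
    have key := h y z z x z z
    refine le_trans ?_ (key.trans ?_)
    · simp [sup_comm]
    · refine sup_le (le_sup_of_le_right (inf_le_inf_left _ (sup_le ?_ le_rfl)))
        (le_sup_of_le_left inf_le_left)
      exact inf_le_left.trans (inf_le_right.trans (sup_le hxz le_rfl))

theorem higherArguesian_three_iff : HigherArguesian 3 L ↔
    ∀ a₁ a₂ a₃ b₁ b₂ b₃ : L, a₃ ⊓ ((a₁ ⊔ b₁) ⊓ (a₂ ⊔ b₂) ⊔ b₃) ≤
      a₁ ⊔ (((a₁ ⊔ a₂) ⊓ (b₁ ⊔ b₂) ⊔ (a₂ ⊔ a₃) ⊓ (b₂ ⊔ b₃)) ⊓ (b₁ ⊔ b₃)) := by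
  have hI : Finset.Icc 1 (3 - 1) = {1, 2} := by decide
  constructor
  · intro h a₁ a₂ a₃ b₁ b₂ b₃
    have := h (by norm_num) (fun i => if i = 1 then a₁ else if i = 2 then a₂ else a₃)
      (fun i => if i = 1 then b₁ else if i = 2 then b₂ else b₃)
    simpa [hI] using this
  · intro h hn a b hne
    simpa [hI] using h (a 1) (a 2) (a 3) (b 1) (b 2) (b 3)

theorem Arguesian.higherArguesian_three (h : Arguesian L) : HigherArguesian 3 L := by
  have := h.isModularLattice
  rw [higherArguesian_three_iff]
  intro a₁ a₂ a₃ b₁ b₂ b₃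
  have key := h a₃ a₁ a₂ b₃ b₁ b₂
  dsimp only at key
  set y := (a₃ ⊔ a₁) ⊓ (b₃ ⊔ b₁) ⊓
    ((a₃ ⊔ a₂) ⊓ (b₃ ⊔ b₂) ⊔ (a₁ ⊔ a₂) ⊓ (b₁ ⊔ b₂)) with hy
  set R := ((a₁ ⊔ a₂) ⊓ (b₁ ⊔ b₂) ⊔ (a₂ ⊔ a₃) ⊓ (b₂ ⊔ b₃)) ⊓ (b₁ ⊔ b₃) with hR
  have hyR : y ≤ R := by
    refine le_inf (inf_le_right.trans (sup_le ?_ le_sup_left)) ?_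
    · exact le_sup_of_le_right (by rw [sup_comm a₃, sup_comm b₃])
    · exact inf_le_left.trans (inf_le_right.trans (sup_comm _ _).le)
  have hab : a₃ ⊓ b₃ ≤ R :=
    le_inf (le_sup_of_le_right (inf_le_inf le_sup_right le_sup_right))
      (inf_le_right.trans le_sup_right)
  calc a₃ ⊓ ((a₁ ⊔ b₁) ⊓ (a₂ ⊔ b₂) ⊔ b₃)
      ≤ a₃ ⊓ (((a₁ ⊔ b₁) ⊓ (a₂ ⊔ b₂) ⊔ b₃) ⊓ (a₃ ⊔ b₃)) :=
        le_inf inf_le_left (le_inf inf_le_right (inf_le_left.trans le_sup_left))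
    _ = a₃ ⊓ ((b₃ ⊔ (a₁ ⊔ b₁) ⊓ (a₂ ⊔ b₂)) ⊓ (a₃ ⊔ b₃)) := by rw [sup_comm _ b₃]
    _ = a₃ ⊓ (b₃ ⊔ (a₁ ⊔ b₁) ⊓ (a₂ ⊔ b₂) ⊓ (a₃ ⊔ b₃)) := by
        rw [sup_inf_assoc_of_le _ (le_sup_right : b₃ ≤ a₃ ⊔ b₃)]
    _ ≤ a₃ ⊓ (b₃ ⊔ a₃ ⊓ (y ⊔ a₁)) := by
        refine inf_le_inf_left _ (sup_le le_sup_left ?_)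
        refine le_trans ?_ (key.trans (sup_le le_sup_right (le_sup_of_le_left inf_le_left)))
        exact le_inf (le_inf inf_le_right (inf_le_left.trans inf_le_left))
          (inf_le_left.trans inf_le_right)
    _ = (a₃ ⊓ (y ⊔ a₁) ⊔ b₃) ⊓ a₃ := by rw [inf_comm, sup_comm]
    _ = a₃ ⊓ (y ⊔ a₁) ⊔ b₃ ⊓ a₃ := sup_inf_assoc_of_le _ inf_le_left
    _ ≤ a₁ ⊔ R := by
        refine sup_le (inf_le_right.trans (sup_le (le_sup_of_le_right hyR) le_sup_left)) ?_
        exact le_sup_of_le_right ((inf_comm _ _).le.trans hab)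

theorem HigherArguesian.arguesian (h : HigherArguesian 3 L) : Arguesian L := by
  have := h.isModularLattice (by norm_num)
  rw [higherArguesian_three_iff] at h
  -- one half of Jónsson's inequality; exchanging the two triangles gives the other half
  have half : ∀ a₀ a₁ a₂ b₀ b₁ b₂ : L, a₀ ⊓ ((a₁ ⊔ b₁) ⊓ (a₂ ⊔ b₂) ⊔ b₀) ≤
      a₀ ⊓ ((a₀ ⊔ a₁) ⊓ (b₀ ⊔ b₁) ⊓
        ((a₀ ⊔ a₂) ⊓ (b₀ ⊔ b₂) ⊔ (a₁ ⊔ a₂) ⊓ (b₁ ⊔ b₂)) ⊔ a₁) := by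
    intro a₀ a₁ a₂ b₀ b₁ b₂
    have key := h a₁ a₂ a₀ b₁ b₂ b₀
    refine le_inf inf_le_left ((le_inf key (inf_le_left.trans le_sup_right :
      _ ≤ a₁ ⊔ a₀)).trans ?_)
    rw [sup_inf_assoc_of_le _ (le_sup_left : a₁ ≤ a₁ ⊔ a₀), sup_comm a₁]
    refine sup_le_sup_right (le_inf (le_inf ?_ ?_) ?_) _
    · exact inf_le_right.trans (sup_comm _ _).le
    · exact (inf_le_left.trans inf_le_right).trans (sup_comm _ _).le
    · refine (inf_le_left.trans inf_le_left).trans (sup_le le_sup_right (le_sup_of_le_left ?_))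
      rw [sup_comm a₂, sup_comm b₂]
  intro a₀ a₁ a₂ b₀ b₁ b₂ y
  set q := (a₁ ⊔ b₁) ⊓ (a₂ ⊔ b₂) with hq
  have h1 : a₀ ⊓ (q ⊔ b₀) ≤ a₀ ⊓ (y ⊔ a₁) := half a₀ a₁ a₂ b₀ b₁ b₂
  have h2 : b₀ ⊓ (q ⊔ a₀) ≤ b₀ ⊓ (y ⊔ b₁) := by
    have := half b₀ b₁ b₂ a₀ a₁ a₂
    rwa [sup_comm b₁ a₁, sup_comm b₂ a₂, inf_comm (b₀ ⊔ b₁), inf_comm (b₀ ⊔ b₂),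
      inf_comm (b₁ ⊔ b₂)] at this
  refine le_trans ?_ (sup_le_sup h1 h2)
  rw [inf_assoc, ← hq,
    ← sup_inf_assoc_of_le b₀ (inf_le_left.trans le_sup_right : a₀ ⊓ (q ⊔ b₀) ≤ q ⊔ a₀)]
  refine le_inf ?_ (inf_le_right.trans le_sup_left)
  rw [sup_comm (a₀ ⊓ _), ← sup_inf_assoc_of_le a₀ (le_sup_right : b₀ ≤ q ⊔ b₀), sup_comm b₀]
  exact inf_le_inf_left _ le_sup_left

theorem higherArguesian_three_iff_arguesian : HigherArguesian 3 L ↔ Arguesian L :=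
  ⟨fun h => h.arguesian, fun h => h.higherArguesian_three⟩

end Lattices

/-! ### Lattices of subspaces, sublattices -/

section Transfer

theorem HigherArguesian.of_injective {L L' : Type*} [Lattice L] [Lattice L'] {n : ℕ}
    (f : LatticeHom L L') (hf : Function.Injective f) (h : HigherArguesian n L') :
    HigherArguesian n L := by
  intro hn a b hne
  have key := h hn (fun i => f (a i)) (fun i => f (b i))
  simp only [← map_sup, ← map_inf] at key
  rw [← Function.comp_def f, ← map_finset_inf', ← map_sup, ← map_inf, ← Function.comp_def f,
    ← map_finset_sup', ← map_inf, ← map_sup] at key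
  rw [← inf_eq_left] at key ⊢
  rw [← map_inf] at key
  exact hf key

/-- A law `HigherArguesian n` valid in a sublattice holds for all assignments whose `2 * n` relevant
values lie in it. -/
theorem HigherArguesian.of_mem_sublattice {L : Type*} [Lattice L] {n : ℕ} (S : Sublattice L)
    (h : HigherArguesian n S) (hn : 2 ≤ n) (a b : ℕ → L)
    (ha : ∀ i ∈ Finset.Icc 1 n, a i ∈ S) (hb : ∀ i ∈ Finset.Icc 1 n, b i ∈ S)
    (hne : (Finset.Icc 1 (n - 1)).Nonempty) :
    a n ⊓ ((Finset.Icc 1 (n - 1)).inf' hne (fun i => a i ⊔ b i) ⊔ b n) ≤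
      a 1 ⊔ ((Finset.Icc 1 (n - 1)).sup' hne (fun i => (a i ⊔ a (i + 1)) ⊓ (b i ⊔ b (i + 1))) ⊓
        (b 1 ⊔ b n)) := by
  have m1 : 1 ∈ Finset.Icc 1 n := Finset.mem_Icc.mpr (by omega)
  have mn : n ∈ Finset.Icc 1 n := Finset.mem_Icc.mpr (by omega)
  have mi : ∀ i ∈ Finset.Icc 1 (n - 1), i ∈ Finset.Icc 1 n ∧ i + 1 ∈ Finset.Icc 1 n := by
    intro i hi
    simp only [Finset.mem_Icc] at hi ⊢
    omega
  have key := h hn (fun i => if h : i ∈ Finset.Icc 1 n then ⟨a i, ha i h⟩ else ⟨a 1, ha 1 m1⟩)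
    (fun i => if h : i ∈ Finset.Icc 1 n then ⟨b i, hb i h⟩ else ⟨b 1, hb 1 m1⟩)
  replace key := (OrderHomClass.mono S.subtype) key
  simp only [map_inf, map_sup, map_finset_inf', map_finset_sup', dif_pos m1, dif_pos mn] at key
  have hi : (Finset.Icc 1 (n - 1)).inf' hne (fun i => a i ⊔ b i) =
      (Finset.Icc 1 (n - 1)).inf' hne (⇑S.subtype ∘ fun i =>
        (if h : i ∈ Finset.Icc 1 n then ⟨a i, ha i h⟩ else ⟨a 1, ha 1 m1⟩ : S) ⊔
        (if h : i ∈ Finset.Icc 1 n then ⟨b i, hb i h⟩ else ⟨b 1, hb 1 m1⟩ : S)) := by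
    refine Finset.inf'_congr _ rfl fun i hi => ?_
    simp [-Finset.mem_Icc, mi i hi]
  have hs : (Finset.Icc 1 (n - 1)).sup' hne
      (fun i => (a i ⊔ a (i + 1)) ⊓ (b i ⊔ b (i + 1))) =
      (Finset.Icc 1 (n - 1)).sup' hne (⇑S.subtype ∘ fun i =>
        ((if h : i ∈ Finset.Icc 1 n then ⟨a i, ha i h⟩ else ⟨a 1, ha 1 m1⟩ : S) ⊔
        (if h : i + 1 ∈ Finset.Icc 1 n then ⟨a (i + 1), ha (i + 1) h⟩ else ⟨a 1, ha 1 m1⟩ : S)) ⊓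
        ((if h : i ∈ Finset.Icc 1 n then ⟨b i, hb i h⟩ else ⟨b 1, hb 1 m1⟩ : S) ⊔
        (if h : i + 1 ∈ Finset.Icc 1 n then ⟨b (i + 1), hb (i + 1) h⟩
          else ⟨b 1, hb 1 m1⟩ : S))) := by
    refine Finset.sup'_congr _ rfl fun i hi => ?_
    simp [-Finset.mem_Icc, mi i hi]
  rw [hi, hs]
  exact key

/-- Subspace lattices satisfy all higher Arguesian laws. For `x = w + y` in the left-hand side,
with `w = p i + q i`, `p i ∈ a i`, `q i ∈ b i`, the differences `p i - p (i + 1)` equal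
`q (i + 1) - q i`, and they telescope. -/
theorem Submodule.higherArguesian {K V : Type*} [Ring K] [AddCommGroup V] [Module K V] (n : ℕ) :
    HigherArguesian n (Submodule K V) := by
  intro hn a b hne x hx
  obtain ⟨hxa, hx⟩ := Submodule.mem_inf.mp hx
  obtain ⟨w, hw, y, hy, rfl⟩ := Submodule.mem_sup.mp hx
  have hpq : ∀ i, 1 ≤ i → i ≤ n → ∃ p ∈ a i, ∃ q ∈ b i, p + q = w := by
    intro i h1 hi
    rcases eq_or_lt_of_le hi with rfl | hlt
    · exact ⟨w + y, hxa, -y, (b i).neg_mem hy, by abel⟩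
    · exact Submodule.mem_sup.mp
        (Finset.inf'_le (fun i => a i ⊔ b i) (Finset.mem_Icc.mpr (by omega)) hw)
  obtain ⟨p₁, hp₁, q₁, hq₁, h₁⟩ := hpq 1 le_rfl (by omega)
  set X := (Finset.Icc 1 (n - 1)).sup' hne (fun i => (a i ⊔ a (i + 1)) ⊓ (b i ⊔ b (i + 1)))
  have tel : ∀ k, 1 ≤ k → k < n → ∀ p ∈ a (k + 1), ∀ q ∈ b (k + 1), p + q = w → p - p₁ ∈ X := by
    have step : ∀ k, 1 ≤ k → k < n → ∀ p ∈ a k, ∀ q ∈ b k, p + q = w →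
        ∀ p' ∈ a (k + 1), ∀ q' ∈ b (k + 1), p' + q' = w → p' - p ∈ X := by
      intro k h1 hk p hp q hq h p' hp' q' hq' h'
      refine Finset.le_sup' (fun i => (a i ⊔ a (i + 1)) ⊓ (b i ⊔ b (i + 1)))
        (Finset.mem_Icc.mpr (by omega : 1 ≤ k ∧ k ≤ n - 1)) (Submodule.mem_inf.mpr ⟨?_, ?_⟩)
      · exact Submodule.sub_mem _ (Submodule.mem_sup_right hp') (Submodule.mem_sup_left hp)
      · have : p' - p = q - q' := by rw [sub_eq_sub_iff_add_eq_add, h', add_comm q, h]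
        rw [this]
        exact Submodule.sub_mem _ (Submodule.mem_sup_left hq) (Submodule.mem_sup_right hq')
    intro k h1
    induction k, h1 using Nat.le_induction with
    | base => exact fun hk => step 1 le_rfl hk p₁ hp₁ q₁ hq₁ h₁
    | succ k h1 ih =>
      intro hk p hp q hq h
      obtain ⟨p', hp', q', hq', h'⟩ := hpq (k + 1) (by omega) hk.le
      have := X.add_mem (step (k + 1) (by omega) hk p' hp' q' hq' h' p hp q hq h)
        (ih (by omega) p' hp' q' hq' h')
      simpa using this
  have hlast : w + y - p₁ ∈ X := by
    obtain ⟨k, rfl⟩ : ∃ k, n = k + 1 := ⟨n - 1, by omega⟩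
    exact tel k (by omega) (by omega) _ hxa (-y) ((b _).neg_mem hy) (by abel)
  have hb : w + y - p₁ ∈ b 1 ⊔ b n := by
    have : w + y - p₁ = q₁ + y := by rw [← h₁]; abel
    rw [this]
    exact Submodule.add_mem_sup hq₁ hy
  have := Submodule.add_mem_sup hp₁ (Submodule.mem_inf.mpr ⟨hlast, hb⟩)
  simpa using this

end Transfer

/-! ### Twisted subspaces -/

namespace TwistedPolygon

/-- The space `P × A` with `P = A = K ^ n`, coordinates being indexed cyclically. In
comments, `f j` is the `j`-th coordinate function of `P` and `α j` the `j`-th basis vector of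
`A`. -/
abbrev Space (K : Type*) (n : ℕ) : Type _ := (ZMod n → K) × (ZMod n → K)

section Subspaces

variable (K : Type*) [Field K] {n : ℕ}

/-- The subspace `P`. -/
def base : Submodule K (Space K n) := LinearMap.ker (LinearMap.snd K _ _)

/-- The subspace `P + ⟨α j⟩`. -/
def wall (j : ZMod n) : Submodule K (Space K n) where
  carrier := {v | ∀ k, k ≠ j → v.2 k = 0}
  add_mem' hv hw k hk := by simp [hv k hk, hw k hk]
  zero_mem' := by simp
  smul_mem' c v hv k hk := by simp [hv k hk]

/-- The subspace `P + ⟨α (j - 1), α j⟩`. -/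
def wedge (j : ZMod n) : Submodule K (Space K n) where
  carrier := {v | ∀ k, k ≠ j - 1 → k ≠ j → v.2 k = 0}
  add_mem' hv hw k hk hk' := by simp [hv k hk hk', hw k hk hk']
  zero_mem' := by simp
  smul_mem' c v hv k hk hk' := by simp [hv k hk hk']

/-- The hyperplane `f j = 0` of `P`. -/
def hyper (j : ZMod n) : Submodule K (Space K n) where
  carrier := {v | v.2 = 0 ∧ v.1 j = 0}
  add_mem' hv hw := by simp [hv.1, hw.1, hv.2, hw.2]
  zero_mem' := by simp
  smul_mem' c v hv := by simp [hv.1, hv.2]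

/-- The subspace `f j = f (j + 1) = 0` of `P`. -/
def axis (j : ZMod n) : Submodule K (Space K n) where
  carrier := {v | v.2 = 0 ∧ v.1 j = 0 ∧ v.1 (j + 1) = 0}
  add_mem' hv hw := by simp [hv.1, hw.1, hv.2.1, hw.2.1, hv.2.2, hw.2.2]
  zero_mem' := by simp
  smul_mem' c v hv := by simp [hv.1, hv.2.1, hv.2.2]

/-- Multiplication by `c` on `A`, the identity on `P`. -/
def scale (c : K) : Space K n →ₗ[K] Space K n :=
  LinearMap.prodMap LinearMap.id (c • LinearMap.id)

end Subspaces

variable {K : Type*} [Field K] {n : ℕ}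

theorem mem_base {v : Space K n} : v ∈ base K ↔ v.2 = 0 := by simp [base]

theorem mem_wedge {j : ZMod n} {v : Space K n} :
    v ∈ wedge K j ↔ ∀ k, k ≠ j - 1 → k ≠ j → v.2 k = 0 := Iff.rfl

theorem scale_apply (c : K) (v : Space K n) : scale K c v = (v.1, c • v.2) := rfl

theorem base_le_wall (j : ZMod n) : base K ≤ wall K j := by
  intro v hv k _
  simp [mem_base.mp hv]

theorem base_le_wedge (j : ZMod n) : base K ≤ wedge K j := by
  intro v hv k _ _
  simp [mem_base.mp hv]

theorem hyper_le_base (j : ZMod n) : hyper K j ≤ base K := fun _ hv => mem_base.mpr hv.1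

theorem axis_le_hyper (j : ZMod n) : axis K j ≤ hyper K j := fun _ hv => ⟨hv.1, hv.2.1⟩

theorem axis_le_hyper_succ (j : ZMod n) : axis K j ≤ hyper K (j + 1) := fun _ hv => ⟨hv.1, hv.2.2⟩

theorem axis_le_base (j : ZMod n) : axis K j ≤ base K := (axis_le_hyper j).trans (hyper_le_base j)

theorem wall_le_wedge (j : ZMod n) : wall K j ≤ wedge K j := fun _ hv k _ hk => hv k hk

theorem wall_le_wedge_succ (j : ZMod n) : wall K j ≤ wedge K (j + 1) :=
  fun _ hv k hk _ => hv k (by simpa using hk)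

theorem wall_inf_wall_le {j k : ZMod n} (h : j ≠ k) : wall K j ⊓ wall K k ≤ base K := by
  rintro v ⟨hj, hk⟩
  refine mem_base.mpr (funext fun m => ?_)
  by_cases hm : m = j
  · exact hk m (hm ▸ h)
  · exact hj m hm

theorem wall_inf_wedge_le {j k : ZMod n} (h : j ≠ k) (h' : j ≠ k - 1) :
    wall K j ⊓ wedge K k ≤ base K := by
  rintro v ⟨hj, hk⟩
  refine mem_base.mpr (funext fun m => ?_)
  by_cases hm : m = j
  · exact hk m (hm ▸ h') (hm ▸ h)
  · exact hj m hm

theorem wedge_inf_wedge_le {j k : ZMod n} (h : j ≠ k) (h' : j ≠ k - 1) (h'' : k ≠ j - 1) :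
    wedge K j ⊓ wedge K k ≤ base K := by
  rintro v ⟨hj, hk⟩
  refine mem_base.mpr (funext fun m => ?_)
  by_cases hm : m = j
  · exact hk m (hm ▸ h') (hm ▸ h)
  · by_cases hm' : m = j - 1
    · refine hk m (fun e => h ?_) (hm' ▸ h''.symm)
      rw [hm'] at e
      exact sub_left_injective e
    · exact hj m hm' hm

theorem two_ne_zero_of_three_le (hn : 3 ≤ n) : (2 : ZMod n) ≠ 0 := by
  intro h
  have : ((2 : ℕ) : ZMod n) = 0 := by exact_mod_cast h
  rw [ZMod.natCast_eq_zero_iff] at this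
  exact absurd (Nat.le_of_dvd (by norm_num) this) (by omega)

theorem succ_ne_pred (hn : 3 ≤ n) (j : ZMod n) : j + 1 ≠ j - 1 := by
  intro h
  refine two_ne_zero_of_three_le hn ?_
  linear_combination h

theorem wedge_inf_wedge_succ_le (hn : 3 ≤ n) (j : ZMod n) :
    wedge K j ⊓ wedge K (j + 1) ≤ wall K j := by
  rintro v ⟨hj, hk⟩ m hm
  by_cases hm' : m = j - 1
  · exact hk m (by simpa using hm) (hm' ▸ (succ_ne_pred hn j).symm)
  · exact hj m hm' hm

theorem scale_of_mem_base {c : K} {v : Space K n} (hv : v ∈ base K) : scale K c v = v := by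
  rw [scale_apply, mem_base.mp hv, smul_zero, ← mem_base.mp hv]

theorem scale_mem_iff {y : Submodule K (Space K n)} (hy : base K ≤ y) {c : K} (hc : c ≠ 0)
    {v : Space K n} : scale K c v ∈ y ↔ v ∈ y := by
  have key : scale K c v = c • v + ((1 - c) • v.1, 0) := by
    ext k <;> simp [scale_apply]
    ring
  have hb : ((1 - c) • v.1, 0) ∈ y := hy (mem_base.mpr rfl)
  rw [key, y.add_mem_iff_left hb, y.smul_mem_iff hc]

open Classical in
/-- The reflection `(p, a) ↦ (p, -a)` on `wall j`, and the identity elsewhere. This is not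
linear; on `wedge j` it serves as the twisted chart. -/
noncomputable def flip (j : ZMod n) (v : Space K n) : Space K n :=
  if v ∈ wall K j then scale K (-1) v else v

theorem flip_of_mem {j : ZMod n} {v : Space K n} (hv : v ∈ wall K j) :
    flip j v = scale K (-1) v := if_pos hv

theorem flip_of_notMem {j : ZMod n} {v : Space K n} (hv : v ∉ wall K j) : flip j v = v :=
  if_neg hv

theorem flip_of_mem_base {j : ZMod n} {v : Space K n} (hv : v ∈ base K) : flip j v = v := by
  rw [flip_of_mem (base_le_wall j hv), scale_of_mem_base hv]

theorem flip_mem_iff {y : Submodule K (Space K n)} (hy : base K ≤ y) {j : ZMod n}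
    {v : Space K n} : flip j v ∈ y ↔ v ∈ y := by
  by_cases hv : v ∈ wall K j
  · rw [flip_of_mem hv, scale_mem_iff hy (neg_ne_zero.mpr one_ne_zero)]
  · rw [flip_of_notMem hv]

/-- Twisted subspaces of `P × A`: the subspaces inside `P`, those containing `P`, for `j ∈ s` those
between `axis j` and `wall j`, and for `j ∈ s` the preimages under `flip j` of those between
`hyper j` and `wedge j`. Consecutive intervals overlap, so that the intervals form a closed
chain, around which the reflections `flip j` accumulate to a nontrivial holonomy if `n` is odd. -/
inductive IsTwisted (s : Set (ZMod n)) : Set (Space K n) → Prop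
  | low (y : Submodule K (Space K n)) (h : y ≤ base K) : IsTwisted s y
  | high (y : Submodule K (Space K n)) (h : base K ≤ y) : IsTwisted s y
  | side (j : ZMod n) (hj : j ∈ s) (y : Submodule K (Space K n)) (h : axis K j ≤ y)
      (h' : y ≤ wall K j) : IsTwisted s y
  | corner (j : ZMod n) (hj : j ∈ s) (y : Submodule K (Space K n)) (h : hyper K j ≤ y)
      (h' : y ≤ wedge K j) : IsTwisted s (flip j ⁻¹' y)

theorem flip_preimage_subset {j : ZMod n} {y z : Submodule K (Space K n)} (hz : base K ≤ z)
    (h : y ≤ z) : flip j ⁻¹' (y : Set (Space K n)) ⊆ z :=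
  fun _ hv => (flip_mem_iff hz).mp (h hv)

theorem subset_flip_preimage {j : ZMod n} {y z : Submodule K (Space K n)} (hz : z ≤ base K)
    (h : z ≤ y) : (z : Set (Space K n)) ⊆ flip j ⁻¹' (y : Set (Space K n)) := by
  intro v hv
  rw [Set.mem_preimage, flip_of_mem_base (hz hv)]
  exact h hv

theorem flip_preimage_of_base_le {j : ZMod n} {y : Submodule K (Space K n)} (hy : base K ≤ y) :
    flip j ⁻¹' (y : Set (Space K n)) = y := by
  ext v
  exact flip_mem_iff hy

namespace IsTwisted

variable {s : Set (ZMod n)} {S S' : Set (Space K n)}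

theorem mono {t : Set (ZMod n)} (hst : s ⊆ t) (h : IsTwisted s S) : IsTwisted t S := by
  cases h with
  | low y h => exact low y h
  | high y h => exact high y h
  | side j hj y h h' => exact side j (hst hj) y h h'
  | corner j hj y h h' => exact corner j (hst hj) y h h'

/-- Although a twisted subspace need not be a subspace, its intersection with a wall is. -/
theorem exists_inter_wall (h : IsTwisted s S) (k : ZMod n) :
    ∃ y : Submodule K (Space K n), S ∩ wall K k = y := by
  cases h with
  | low y => exact ⟨y ⊓ wall K k, rfl⟩
  | high y => exact ⟨y ⊓ wall K k, rfl⟩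
  | side j _ y => exact ⟨y ⊓ wall K k, rfl⟩
  | corner j _ y =>
    by_cases hjk : j = k
    · subst hjk
      refine ⟨y.comap (scale K (-1)) ⊓ wall K j, Set.ext fun v => ?_⟩
      refine and_congr_left fun hv => ?_
      rw [Set.mem_preimage, flip_of_mem hv]
      rfl
    · refine ⟨y ⊓ wall K k, Set.ext fun v => and_congr_left fun hv => ?_⟩
      rw [Set.mem_preimage]
      by_cases hv' : v ∈ wall K j
      · rw [flip_of_mem_base (wall_inf_wall_le hjk ⟨hv', hv⟩)]
      · rw [flip_of_notMem hv']

theorem exists_inter_base (h : IsTwisted s S) :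
    ∃ y : Submodule K (Space K n), S ∩ (base K : Submodule K (Space K n)) = y := by
  obtain ⟨y, hy⟩ := h.exists_inter_wall 0
  refine ⟨y ⊓ base K, ?_⟩
  rw [Submodule.coe_inf, ← hy, Set.inter_assoc,
    Set.inter_eq_right.mpr (SetLike.coe_subset_coe.mpr (base_le_wall 0))]

theorem inter_of_subset_base (h : IsTwisted s S) (h' : IsTwisted s S')
    (hb : S ∩ S' ⊆ (base K : Submodule K (Space K n))) :
    IsTwisted s (S ∩ S') := by
  obtain ⟨y, hy⟩ := h.exists_inter_base
  obtain ⟨y', hy'⟩ := h'.exists_inter_base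
  have : S ∩ S' = (y ⊓ y' : Submodule K (Space K n)) := by
    rw [Submodule.coe_inf, ← hy, ← hy', ← Set.inter_inter_distrib_right,
      Set.inter_eq_left.mpr hb]
  rw [this]
  exact low _ (SetLike.coe_subset_coe.mp (this ▸ hb))

theorem inter_of_subset_wall (h : IsTwisted s S) (h' : IsTwisted s S') {j : ZMod n} (hj : j ∈ s)
    (ha : (axis K j : Set (Space K n)) ⊆ S) (ha' : (axis K j : Set (Space K n)) ⊆ S')
    (hw : S ∩ S' ⊆ wall K j) : IsTwisted s (S ∩ S') := by
  obtain ⟨y, hy⟩ := h.exists_inter_wall j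
  obtain ⟨y', hy'⟩ := h'.exists_inter_wall j
  have : S ∩ S' = (y ⊓ y' : Submodule K (Space K n)) := by
    rw [Submodule.coe_inf, ← hy, ← hy', ← Set.inter_inter_distrib_right,
      Set.inter_eq_left.mpr hw]
  have hax := Set.subset_inter ha ha'
  rw [this] at hw hax ⊢
  exact side j hj _ hax hw

theorem low_inter {y : Submodule K (Space K n)} (hy : y ≤ base K) (h : IsTwisted s S) :
    IsTwisted s (y ∩ S) :=
  (low y hy).inter_of_subset_base h (Set.inter_subset_left.trans hy)

theorem high_inter {y : Submodule K (Space K n)} (hy : base K ≤ y) (h : IsTwisted s S) :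
    IsTwisted s (y ∩ S) := by
  cases h with
  | low z h => exact low (y ⊓ z) (inf_le_right.trans h)
  | high z h => exact high (y ⊓ z) (le_inf hy h)
  | side j hj z h h' =>
    exact side j hj (y ⊓ z) (le_inf ((axis_le_base j).trans hy) h) (inf_le_right.trans h')
  | corner j hj z h h' =>
    rw [← flip_preimage_of_base_le (j := j) hy, ← Set.preimage_inter]
    exact corner j hj (y ⊓ z) (le_inf ((hyper_le_base j).trans hy) h) (inf_le_right.trans h')

theorem side_inter_corner {j k : ZMod n} (hj : j ∈ s) (hk : k ∈ s)
    {y z : Submodule K (Space K n)} (hy : axis K j ≤ y) (hy' : y ≤ wall K j)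
    (hz : hyper K k ≤ z) (hz' : z ≤ wedge K k) :
    IsTwisted s (y ∩ flip k ⁻¹' (z : Set (Space K n))) := by
  by_cases h : j = k ∨ j = k - 1
  · refine (side j hj y hy hy').inter_of_subset_wall (corner k hk z hz hz') hj hy ?_
      (Set.inter_subset_left.trans hy')
    refine subset_flip_preimage (axis_le_base j) (le_trans ?_ hz)
    rcases h with rfl | rfl
    · exact axis_le_hyper _
    · exact (axis_le_hyper_succ _).trans (by rw [sub_add_cancel])
  · rw [not_or] at h
    refine (side j hj y hy hy').inter_of_subset_base (corner k hk z hz hz') ?_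
    exact (Set.inter_subset_inter hy' (flip_preimage_subset (base_le_wedge k) hz')).trans
      (wall_inf_wedge_le h.1 h.2)

theorem corner_inter_corner_succ (hn : 3 ≤ n) {j : ZMod n} (hj : j ∈ s) (hk : j + 1 ∈ s)
    {y z : Submodule K (Space K n)} (hy : hyper K j ≤ y) (hy' : y ≤ wedge K j)
    (hz : hyper K (j + 1) ≤ z) (hz' : z ≤ wedge K (j + 1)) :
    IsTwisted s (flip j ⁻¹' (y : Set (Space K n)) ∩ flip (j + 1) ⁻¹' (z : Set (Space K n))) := by
  refine (corner j hj y hy hy').inter_of_subset_wall (corner _ hk z hz hz') hj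
    (subset_flip_preimage (axis_le_base j) ((axis_le_hyper j).trans hy))
    (subset_flip_preimage (axis_le_base j) ((axis_le_hyper_succ j).trans hz)) ?_
  exact (Set.inter_subset_inter (flip_preimage_subset (base_le_wedge _) hy')
    (flip_preimage_subset (base_le_wedge _) hz')).trans (wedge_inf_wedge_succ_le hn j)

theorem inter (hn : 3 ≤ n) (h : IsTwisted s S) (h' : IsTwisted s S') : IsTwisted s (S ∩ S') := by
  cases h with
  | low y hy => exact h'.low_inter hy
  | high y hy => exact h'.high_inter hy
  | side j hj y hy hy' =>
    cases h' with
    | low z hz => exact Set.inter_comm _ _ ▸ (side j hj y hy hy').low_inter hz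
    | high z hz => exact Set.inter_comm _ _ ▸ (side j hj y hy hy').high_inter hz
    | side k hk z hz hz' =>
      by_cases hjk : j = k
      · subst hjk
        exact side j hj (y ⊓ z) (le_inf hy hz) (inf_le_left.trans hy')
      · exact low (y ⊓ z) ((inf_le_inf hy' hz').trans (wall_inf_wall_le hjk))
    | corner k hk z hz hz' => exact side_inter_corner hj hk hy hy' hz hz'
  | corner j hj y hy hy' =>
    cases h' with
    | low z hz => exact Set.inter_comm _ _ ▸ (corner j hj y hy hy').low_inter hz
    | high z hz => exact Set.inter_comm _ _ ▸ (corner j hj y hy hy').high_inter hz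
    | side k hk z hz hz' => exact Set.inter_comm _ _ ▸ side_inter_corner hk hj hz hz' hy hy'
    | corner k hk z hz hz' =>
      by_cases hjk : j = k
      · subst hjk
        exact corner j hj (y ⊓ z) (le_inf hy hz) (inf_le_left.trans hy')
      · by_cases h1 : j = k - 1
        · obtain rfl : k = j + 1 := by rw [h1, sub_add_cancel]
          exact corner_inter_corner_succ hn hj hk hy hy' hz hz'
        · by_cases h2 : k = j - 1
          · obtain rfl : j = k + 1 := by rw [h2, sub_add_cancel]
            exact Set.inter_comm _ _ ▸ corner_inter_corner_succ hn hk hj hz hz' hy hy'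
          · refine (corner j hj y hy hy').inter_of_subset_base (corner k hk z hz hz') ?_
            exact (Set.inter_subset_inter (flip_preimage_subset (base_le_wedge j) hy')
              (flip_preimage_subset (base_le_wedge k) hz')).trans
              (wedge_inf_wedge_le hjk h1 h2)

theorem sInter [Finite K] [NeZero n] (hn : 3 ≤ n) (C : Set (Set (Space K n)))
    (hC : ∀ S ∈ C, IsTwisted s S) : IsTwisted s (⋂₀ C) := by
  induction C, C.toFinite using Set.Finite.induction_on with
  | empty =>
    rw [Set.sInter_empty]
    exact high ⊤ le_top
  | insert _ _ ih =>
    rw [Set.sInter_insert]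
    exact (hC _ (Set.mem_insert _ _)).inter hn (ih fun S hS => hC S (Set.mem_insert_of_mem _ hS))

end IsTwisted

/-! ### Straightening the twist -/

/-- The untwisted counterpart of `IsTwisted`: the same intervals of subspaces, without the charts
`flip j`. -/
def IsStraight (s : Set (ZMod n)) (y : Submodule K (Space K n)) : Prop :=
  y ≤ base K ∨ base K ≤ y ∨ (∃ j ∈ s, axis K j ≤ y ∧ y ≤ wall K j) ∨
    ∃ j ∈ s, hyper K j ≤ y ∧ y ≤ wedge K j

theorem hyper_sup_hyper {j k : ZMod n} (h : j ≠ k) : hyper K j ⊔ hyper K k = base K := by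
  refine le_antisymm (sup_le (hyper_le_base j) (hyper_le_base k)) fun v hv => ?_
  have hv := mem_base.mp hv
  refine Submodule.mem_sup.mpr ⟨(v.1 - Pi.single j (v.1 j), 0), ⟨rfl, by simp⟩,
    (Pi.single j (v.1 j), 0), ⟨rfl, by simp [h.symm]⟩, ?_⟩
  ext m <;> simp [hv]

theorem axis_sup_hyper {j k : ZMod n} (h : k ≠ j) (h' : k ≠ j + 1) :
    axis K j ⊔ hyper K k = base K := by
  refine le_antisymm (sup_le (axis_le_base j) (hyper_le_base k)) fun v hv => ?_
  have hv := mem_base.mp hv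
  refine Submodule.mem_sup.mpr ⟨(Pi.single k (v.1 k), 0),
    ⟨rfl, by simp [h.symm], by simp [h'.symm]⟩,
    (v.1 - Pi.single k (v.1 k), 0), ⟨rfl, by simp⟩, ?_⟩
  ext m <;> simp [hv]

theorem axis_sup_axis {j k : ZMod n} (h : j ≠ k) (h' : k ≠ j + 1) (h'' : j ≠ k + 1) :
    axis K j ⊔ axis K k = base K := by
  refine le_antisymm (sup_le (axis_le_base j) (axis_le_base k)) fun v hv => ?_
  have hv := mem_base.mp hv
  have h3 : k + 1 ≠ j + 1 := fun e => h (add_right_cancel e).symm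
  classical
  let w : ZMod n → K := fun m => if m = j ∨ m = j + 1 then v.1 m else 0
  refine Submodule.mem_sup.mpr ⟨(v.1 - w, 0), ⟨rfl, by simp [w], by simp [w]⟩,
    (w, 0), ⟨rfl, by simp [w, h.symm, h'], by simp [w, h''.symm, h3]⟩, ?_⟩
  ext m <;> simp [hv]

theorem axis_sup_axis_succ (hn : 3 ≤ n) (j : ZMod n) :
    hyper K (j + 1) ≤ axis K j ⊔ axis K (j + 1) := by
  rintro v ⟨hv, hv'⟩
  have h1 : j ≠ j + 1 + 1 := fun e => succ_ne_pred hn j (by linear_combination - e)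
  have h2 : j ≠ j + 1 := fun e => h1 (by linear_combination 2 * e)
  refine Submodule.mem_sup.mpr ⟨(v.1 - Pi.single j (v.1 j), 0),
    ⟨rfl, by simp, by simp [h2.symm, hv']⟩,
    (Pi.single j (v.1 j), 0), ⟨rfl, by simp [h2.symm], by simp [h1.symm]⟩, ?_⟩
  ext m <;> simp [hv]

namespace IsStraight

variable {s : Set (ZMod n)} {y z : Submodule K (Space K n)}

theorem sup_of_le_base (hz : z ≤ base K) (h : IsStraight s y) : IsStraight s (y ⊔ z) := by
  rcases h with h | h | ⟨j, hj, h, h'⟩ | ⟨j, hj, h, h'⟩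
  · exact Or.inl (sup_le h hz)
  · exact Or.inr (Or.inl (le_sup_of_le_left h))
  · exact Or.inr (Or.inr (Or.inl ⟨j, hj, le_sup_of_le_left h,
      sup_le h' (hz.trans (base_le_wall j))⟩))
  · exact Or.inr (Or.inr (Or.inr ⟨j, hj, le_sup_of_le_left h,
      sup_le h' (hz.trans (base_le_wedge j))⟩))

theorem side_sup_corner {j k : ZMod n} (hk : k ∈ s) (hy : axis K j ≤ y) (hy' : y ≤ wall K j)
    (hz : hyper K k ≤ z) (hz' : z ≤ wedge K k) : IsStraight s (y ⊔ z) := by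
  by_cases h1 : k = j
  · subst h1
    exact Or.inr (Or.inr (Or.inr ⟨k, hk, le_sup_of_le_right hz,
      sup_le (hy'.trans (wall_le_wedge k)) hz'⟩))
  · by_cases h2 : k = j + 1
    · subst h2
      exact Or.inr (Or.inr (Or.inr ⟨_, hk, le_sup_of_le_right hz,
        sup_le (hy'.trans (wall_le_wedge_succ j)) hz'⟩))
    · exact Or.inr (Or.inl ((axis_sup_hyper h1 h2).symm.le.trans (sup_le_sup hy hz)))

theorem side_sup_side_succ (hn : 3 ≤ n) {j : ZMod n} (hk : j + 1 ∈ s) (hy : axis K j ≤ y)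
    (hy' : y ≤ wall K j) (hz : axis K (j + 1) ≤ z) (hz' : z ≤ wall K (j + 1)) :
    IsStraight s (y ⊔ z) :=
  Or.inr (Or.inr (Or.inr ⟨j + 1, hk, (axis_sup_axis_succ hn j).trans (sup_le_sup hy hz),
    sup_le (hy'.trans (wall_le_wedge_succ j)) (hz'.trans (wall_le_wedge _))⟩))

theorem sup (hn : 3 ≤ n) (h : IsStraight s y) (h' : IsStraight s z) : IsStraight s (y ⊔ z) := by
  rcases h with hy | hy | ⟨j, hj, hy, hy'⟩ | ⟨j, hj, hy, hy'⟩
  · exact sup_comm y z ▸ h'.sup_of_le_base hy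
  · exact Or.inr (Or.inl (le_sup_of_le_left hy))
  · rcases h' with hz | hz | ⟨k, hk, hz, hz'⟩ | ⟨k, hk, hz, hz'⟩
    · exact sup_of_le_base hz (Or.inr (Or.inr (Or.inl ⟨j, hj, hy, hy'⟩)))
    · exact Or.inr (Or.inl (le_sup_of_le_right hz))
    · by_cases h1 : j = k
      · subst h1
        exact Or.inr (Or.inr (Or.inl ⟨j, hj, le_sup_of_le_left hy, sup_le hy' hz'⟩))
      · by_cases h2 : k = j + 1
        · subst h2
          exact side_sup_side_succ hn hk hy hy' hz hz'
        · by_cases h3 : j = k + 1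
          · subst h3
            exact sup_comm z y ▸ side_sup_side_succ hn hj hz hz' hy hy'
          · exact Or.inr (Or.inl ((axis_sup_axis h1 h2 h3).symm.le.trans (sup_le_sup hy hz)))
    · exact side_sup_corner hk hy hy' hz hz'
  · rcases h' with hz | hz | ⟨k, hk, hz, hz'⟩ | ⟨k, hk, hz, hz'⟩
    · exact sup_of_le_base hz (Or.inr (Or.inr (Or.inr ⟨j, hj, hy, hy'⟩)))
    · exact Or.inr (Or.inl (le_sup_of_le_right hz))
    · exact sup_comm z y ▸ side_sup_corner hj hz hz' hy hy'
    · by_cases h1 : j = k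
      · subst h1
        exact Or.inr (Or.inr (Or.inr ⟨j, hj, le_sup_of_le_left hy, sup_le hy' hz'⟩))
      · exact Or.inr (Or.inl ((hyper_sup_hyper h1).symm.le.trans (sup_le_sup hy hz)))

theorem comap_scale {c : K} (hc : c ≠ 0) (h : IsStraight s y) :
    IsStraight s (y.comap (scale K c)) := by
  have lower : ∀ {x : Submodule K (Space K n)}, x ≤ base K → x ≤ y → x ≤ y.comap (scale K c) := by
    intro x hx hxy v hv
    rw [Submodule.mem_comap, scale_of_mem_base (hx hv)]
    exact hxy hv
  have upper : ∀ {x : Submodule K (Space K n)}, base K ≤ x → y ≤ x → y.comap (scale K c) ≤ x :=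
    fun hx hyx v hv => (scale_mem_iff hx hc).mp (hyx hv)
  rcases h with h | h | ⟨j, hj, h, h'⟩ | ⟨j, hj, h, h'⟩
  · exact Or.inl (upper le_rfl h)
  · exact Or.inr (Or.inl (lower le_rfl h))
  · exact Or.inr (Or.inr (Or.inl ⟨j, hj, lower (axis_le_base j) h, upper (base_le_wall j) h'⟩))
  · exact Or.inr (Or.inr (Or.inr ⟨j, hj, lower (hyper_le_base j) h, upper (base_le_wedge j) h'⟩))

end IsStraight

/-- The sign attached to `a ∈ A` when the chain of charts is cut open at `i`: the parity of the
distance from `i` to the first index, counted upwards from `i`, at which `a` does not vanish. -/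
noncomputable def sign (i : ZMod n) (a : ZMod n → K) : K :=
  (-1) ^ sInf {m : ℕ | a (i + m) ≠ 0}

theorem sign_mul_self (i : ZMod n) (a : ZMod n → K) : sign i a * sign i a = 1 := by
  rw [sign, ← mul_pow]
  simp

theorem sign_ne_zero (i : ZMod n) (a : ZMod n → K) : sign i a ≠ 0 :=
  left_ne_zero_of_mul_eq_one (sign_mul_self i a)

theorem sign_smul (i : ZMod n) {c : K} (hc : c ≠ 0) (a : ZMod n → K) :
    sign i (c • a) = sign i a := by
  simp [sign, hc]

theorem sign_eq {i : ZMod n} {a : ZMod n → K} {m : ℕ} (hm : a (i + m) ≠ 0)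
    (h : ∀ k < m, a (i + k) = 0) : sign i a = (-1) ^ m := by
  have : IsLeast {m : ℕ | a (i + m) ≠ 0} m :=
    ⟨hm, fun k hk => not_lt.mp fun hlt => hk (h k hlt)⟩
  rw [sign, this.csInf_eq]

/-- The bijection of `P × A` that turns the twisted subspaces not using the index `i` into honest
subspaces. -/
noncomputable def straighten (i : ZMod n) (v : Space K n) : Space K n := scale K (sign i v.2) v

theorem straighten_straighten (i : ZMod n) (v : Space K n) :
    straighten i (straighten i v) = v := by
  have h : sign i (sign i v.2 • v.2) = sign i v.2 := sign_smul i (sign_ne_zero i _) _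
  simp only [straighten, scale_apply, h, smul_smul, sign_mul_self, one_smul]

theorem straighten_preimage_preimage (i : ZMod n) (S : Set (Space K n)) :
    straighten i ⁻¹' (straighten i ⁻¹' S) = S := by
  ext v
  simp [straighten_straighten]

theorem straighten_mem_iff {y : Submodule K (Space K n)} (hy : base K ≤ y) {i : ZMod n}
    {v : Space K n} : straighten i v ∈ y ↔ v ∈ y :=
  scale_mem_iff hy (sign_ne_zero i _)

theorem straighten_of_mem_base {i : ZMod n} {v : Space K n} (hv : v ∈ base K) :
    straighten i v = v := scale_of_mem_base hv

/-- On a wall, straightening is linear. -/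
theorem exists_straighten_eq_scale (i k : ZMod n) :
    ∃ c : K, c * c = 1 ∧ ∀ v ∈ wall K k, straighten i v = scale K c v := by
  refine ⟨sign i (Pi.single k 1), sign_mul_self i _, fun v hv => ?_⟩
  have h : v.2 = v.2 k • Pi.single k (1 : K) := by
    ext m
    by_cases hm : m = k
    · subst hm; simp
    · simp [hm, hv m hm]
  by_cases h0 : v.2 k = 0
  · rw [h0, zero_smul] at h
    have hb := mem_base.mpr h
    rw [straighten_of_mem_base hb, scale_of_mem_base hb]
  · rw [straighten, h, sign_smul i h0]

/-- Away from the cut, straightening undoes the twisted charts. -/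
theorem exists_straighten_eq_scale_flip [NeZero n] {i j : ZMod n} (hij : j ≠ i) :
    ∃ c : K, c * c = 1 ∧ ∀ v ∈ wedge K j, straighten i v = scale K c (flip j v) := by
  obtain ⟨m, hm, hmn, rfl⟩ : ∃ m : ℕ, 1 ≤ m ∧ m < n ∧ i + m = j := by
    refine ⟨(j - i).val, Nat.one_le_iff_ne_zero.mpr ?_, ZMod.val_lt _, by simp⟩
    rw [Ne, ZMod.val_eq_zero]
    exact sub_ne_zero.mpr hij
  have hpred : i + (m : ZMod n) - 1 = i + (m - 1 : ℕ) := by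
    rw [Nat.cast_sub hm]
    push_cast
    ring
  have hinj : ∀ {k l : ℕ}, k < n → l < n → k ≠ l → i + (k : ZMod n) ≠ i + (l : ZMod n) := by
    intro k l hk hl hkl h
    have := (ZMod.natCast_eq_natCast_iff' k l n).mp (add_left_cancel h)
    rw [Nat.mod_eq_of_lt hk, Nat.mod_eq_of_lt hl] at this
    exact hkl this
  refine ⟨(-1) ^ (m - 1), by rw [← mul_pow]; simp, fun v hv => ?_⟩
  rw [mem_wedge, hpred] at hv
  by_cases hb : v ∈ base K
  · rw [straighten_of_mem_base hb, flip_of_mem_base hb, scale_of_mem_base hb]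
  by_cases hw : v ∈ wall K (i + m : ZMod n)
  · have hne : v.2 (i + m) ≠ 0 := by
      intro h0
      refine hb (mem_base.mpr (funext fun k => ?_))
      by_cases hk : k = i + m
      · rw [hk, h0]; rfl
      · exact hw k hk
    have hs : sign i v.2 = (-1) ^ m :=
      sign_eq hne fun k hk => hw _ (hinj (hk.trans hmn) hmn hk.ne)
    rw [flip_of_mem hw, straighten, hs, scale_apply, scale_apply, scale_apply, smul_smul,
      ← pow_succ, Nat.sub_add_cancel hm]
  · have hne : v.2 (i + (m - 1 : ℕ)) ≠ 0 := by
      intro h0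
      refine hw fun k hk => ?_
      by_cases hk' : k = i + (m - 1 : ℕ)
      · rw [hk', h0]
      · exact hv k hk' hk
    have hs : sign i v.2 = (-1) ^ (m - 1) :=
      sign_eq hne fun k hk => hv _ (hinj (by omega) (by omega) hk.ne)
        (hinj (by omega) (by omega) (by omega))
    rw [flip_of_notMem hw, straighten, hs]

theorem flip_scale_flip {c : K} (hc : c ≠ 0) (j : ZMod n) (v : Space K n) :
    flip j (scale K c (flip j v)) = scale K c v := by
  by_cases hv : v ∈ wall K j
  · have hv' : scale K c (scale K (-1) v) ∈ wall K j :=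
      (scale_mem_iff (base_le_wall j) hc).mpr
        ((scale_mem_iff (base_le_wall j) (neg_ne_zero.mpr one_ne_zero)).mpr hv)
    rw [flip_of_mem hv, flip_of_mem hv']
    simp [scale_apply]
  · rw [flip_of_notMem hv, flip_of_notMem]
    rwa [scale_mem_iff (base_le_wall j) hc]

theorem preimage_eq_comap_scale {t : Space K n → Space K n} {c : K} (hc : c ≠ 0)
    {y U : Submodule K (Space K n)} (hU : base K ≤ U) (hy : y ≤ U)
    (ht : ∀ v, t v ∈ U ↔ v ∈ U) (h : ∀ v ∈ U, t v = scale K c v) :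
    t ⁻¹' (y : Set (Space K n)) = y.comap (scale K c) := by
  ext v
  by_cases hv : v ∈ U
  · rw [Set.mem_preimage, h v hv]
    rfl
  · refine iff_of_false (fun h => hv ((ht v).mp (hy h))) fun h => hv ?_
    exact (scale_mem_iff hU hc).mp (hy h)

theorem straighten_preimage_of_le_wall (i : ZMod n) {k : ZMod n} {y : Submodule K (Space K n)}
    (hy : y ≤ wall K k) :
    ∃ c : K, c ≠ 0 ∧ straighten i ⁻¹' (y : Set (Space K n)) = y.comap (scale K c) := by
  obtain ⟨c, hc, h⟩ := exists_straighten_eq_scale (K := K) i k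
  have hc := left_ne_zero_of_mul_eq_one hc
  exact ⟨c, hc, preimage_eq_comap_scale hc (base_le_wall k) hy
    (fun v => straighten_mem_iff (base_le_wall k)) h⟩

theorem straighten_preimage_of_base_le (i : ZMod n) {y : Submodule K (Space K n)}
    (hy : base K ≤ y) : straighten i ⁻¹' (y : Set (Space K n)) = y := by
  ext v
  exact straighten_mem_iff hy

theorem straighten_preimage_of_le_base (i : ZMod n) {y : Submodule K (Space K n)}
    (hy : y ≤ base K) : straighten i ⁻¹' (y : Set (Space K n)) = y := by
  ext v
  refine ⟨fun h => ?_, fun h => ?_⟩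
  · have hv := (straighten_mem_iff le_rfl).mp (hy h)
    rwa [Set.mem_preimage, straighten_of_mem_base hv] at h
  · rwa [Set.mem_preimage, straighten_of_mem_base (hy h)]

theorem IsTwisted.exists_isStraight [NeZero n] {i : ZMod n} {S : Set (Space K n)}
    (h : IsTwisted {i}ᶜ S) :
    ∃ y : Submodule K (Space K n), straighten i ⁻¹' S = y ∧ IsStraight {i}ᶜ y := by
  cases h with
  | low y h => exact ⟨y, straighten_preimage_of_le_base i h, Or.inl h⟩
  | high y h => exact ⟨y, straighten_preimage_of_base_le i h, Or.inr (Or.inl h)⟩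
  | side j hj y h h' =>
    obtain ⟨c, hc, e⟩ := straighten_preimage_of_le_wall i h'
    exact ⟨_, e, IsStraight.comap_scale hc (Or.inr (Or.inr (Or.inl ⟨j, hj, h, h'⟩)))⟩
  | corner j hj y h h' =>
    obtain ⟨c, hc, e⟩ := exists_straighten_eq_scale_flip (K := K) hj
    have hc' := left_ne_zero_of_mul_eq_one hc
    refine ⟨y.comap (scale K c), ?_,
      IsStraight.comap_scale hc' (Or.inr (Or.inr (Or.inr ⟨j, hj, h, h'⟩)))⟩
    rw [← Set.preimage_comp]
    refine preimage_eq_comap_scale hc' (base_le_wedge j) h' (fun v => ?_) fun v hv => ?_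
    · exact (flip_mem_iff (base_le_wedge j)).trans (straighten_mem_iff (base_le_wedge j))
    · rw [Function.comp_apply, e v hv, flip_scale_flip hc']

theorem IsStraight.isTwisted [NeZero n] {i : ZMod n} {y : Submodule K (Space K n)}
    (h : IsStraight {i}ᶜ y) : IsTwisted {i}ᶜ (straighten i ⁻¹' (y : Set (Space K n))) := by
  rcases h with h | h | ⟨j, hj, h, h'⟩ | ⟨j, hj, h, h'⟩
  · rw [straighten_preimage_of_le_base i h]
    exact .low y h
  · rw [straighten_preimage_of_base_le i h]
    exact .high y h
  · obtain ⟨c, hc, e⟩ := straighten_preimage_of_le_wall i h'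
    have lower : axis K j ≤ y.comap (scale K c) := fun v hv => by
      rw [Submodule.mem_comap, scale_of_mem_base (axis_le_base j hv)]
      exact h hv
    rw [e]
    exact .side j hj _ lower fun v hv => (scale_mem_iff (base_le_wall j) hc).mp (h' hv)
  · obtain ⟨c, hc, e⟩ := exists_straighten_eq_scale_flip (K := K) hj
    have hc := left_ne_zero_of_mul_eq_one hc
    have upper : y.comap (scale K c) ≤ wedge K j :=
      fun v hv => (scale_mem_iff (base_le_wedge j) hc).mp (h' hv)
    have lower : hyper K j ≤ y.comap (scale K c) := fun v hv => by
      rw [Submodule.mem_comap, scale_of_mem_base (hyper_le_base j hv)]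
      exact h hv
    have : straighten i ⁻¹' (y : Set (Space K n)) =
        flip j ⁻¹' (y.comap (scale K c) : Submodule K (Space K n)) := by
      ext v
      by_cases hv : v ∈ wedge K j
      · rw [Set.mem_preimage, e v hv]
        rfl
      · refine iff_of_false (fun hy => hv ?_) fun hy => hv ?_
        · exact (straighten_mem_iff (base_le_wedge j)).mp (h' hy)
        · exact (flip_mem_iff (base_le_wedge j)).mp (upper hy)
    rw [this]
    exact .corner j hj _ lower upper

theorem IsTwisted.hyper_subset_or (hn : 3 ≤ n) {i : ZMod n} {S : Set (Space K n)}
    (h : IsTwisted {i}ᶜ S) (hw : S ⊆ wedge K i) :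
    (∃ j ≠ i, (hyper K j : Set (Space K n)) ⊆ S) ∨ S ⊆ wall K (i - 1) := by
  cases h with
  | low y h => exact Or.inr (h.trans (base_le_wall _))
  | high y h =>
    refine Or.inl ⟨i + 1, fun e => ?_, (hyper_le_base _).trans h⟩
    exact succ_ne_pred hn i (by linear_combination 2 * e)
  | side j hj y h h' =>
    by_cases hji : j = i - 1
    · exact Or.inr (hji ▸ h')
    · exact Or.inr (((le_inf h' hw).trans (wall_inf_wedge_le hj hji)).trans (base_le_wall _))
  | corner j hj y h h' => exact Or.inl ⟨j, hj, subset_flip_preimage (hyper_le_base j) h⟩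

/-- If `S` and `T` do not use the index `i`, then every twisted subspace containing both, whether or
not it uses `i`, contains the one that straightens to the sum of their straightenings. Hence joins
of such elements in the lattice of all twisted subspaces are computed by sums of subspaces. -/
theorem straighten_sup_subset [NeZero n] (hn : 3 ≤ n) {i : ZMod n} {S T U : Set (Space K n)}
    (hS : IsTwisted {i}ᶜ S) (hT : IsTwisted {i}ᶜ T) (hU : IsTwisted Set.univ U)
    (hSU : S ⊆ U) (hTU : T ⊆ U)
    {y z : Submodule K (Space K n)} (hy : straighten i ⁻¹' S = y)
    (hz : straighten i ⁻¹' T = z) :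
    straighten i ⁻¹' ((y ⊔ z : Submodule K (Space K n)) : Set (Space K n)) ⊆ U := by
  -- it is enough to find a set between `S ∪ T` and `U` that straightens to a subspace
  have reduce : ∀ (U' : Set (Space K n)) (x : Submodule K (Space K n)), U' ⊆ U → S ⊆ U' →
      T ⊆ U' → straighten i ⁻¹' U' = x →
      straighten i ⁻¹' ((y ⊔ z : Submodule K (Space K n)) : Set (Space K n)) ⊆ U := by
    intro U' x hU' hSU' hTU' hx
    have h : y ⊔ z ≤ x := by
      refine sup_le ?_ ?_
      · rw [← SetLike.coe_subset_coe, ← hy, ← hx]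
        exact Set.preimage_mono hSU'
      · rw [← SetLike.coe_subset_coe, ← hz, ← hx]
        exact Set.preimage_mono hTU'
    refine (Set.preimage_mono (SetLike.coe_subset_coe.mpr h)).trans ?_
    rwa [← hx, straighten_preimage_preimage]
  cases hU with
  | low u hu => exact reduce _ _ le_rfl hSU hTU (straighten_preimage_of_le_base i hu)
  | high u hu => exact reduce _ _ le_rfl hSU hTU (straighten_preimage_of_base_le i hu)
  | side j _ u _ hu =>
    obtain ⟨c, -, e⟩ := straighten_preimage_of_le_wall i hu
    exact reduce _ _ le_rfl hSU hTU e
  | corner j _ u hu hu' =>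
    by_cases hij : j = i
    · subst hij
      -- a set using another index cannot lie in `flip j ⁻¹' u` unless this contains `P`
      have high : ∀ k ≠ j, (hyper K k : Set (Space K n)) ⊆ flip j ⁻¹' (u : Set (Space K n)) →
          straighten j ⁻¹' ((y ⊔ z : Submodule K (Space K n)) : Set (Space K n)) ⊆
            flip j ⁻¹' (u : Set (Space K n)) := by
        intro k hk h
        have hbu : base K ≤ u := by
          rw [← hyper_sup_hyper hk]
          refine sup_le (fun v hv => ?_) hu
          rw [← flip_of_mem_base (j := j) (hyper_le_base k hv)]
          exact h hv
        rw [flip_preimage_of_base_le hbu] at hSU hTU reduce ⊢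
        exact reduce _ _ le_rfl hSU hTU (straighten_preimage_of_base_le j hbu)
      have hUw := flip_preimage_subset (j := j) (base_le_wedge j) hu'
      rcases hS.hyper_subset_or hn (hSU.trans hUw) with ⟨k, hk, h⟩ | hS'
      · exact high k hk (h.trans hSU)
      rcases hT.hyper_subset_or hn (hTU.trans hUw) with ⟨k, hk, h⟩ | hT'
      · exact high k hk (h.trans hTU)
      obtain ⟨x, hx⟩ := (IsTwisted.corner (s := Set.univ) j trivial u hu hu').exists_inter_wall
        (j - 1)
      have hxw : x ≤ wall K (j - 1) := by
        rw [← SetLike.coe_subset_coe, ← hx]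
        exact Set.inter_subset_right
      obtain ⟨c, -, e⟩ := straighten_preimage_of_le_wall j hxw
      rw [← hx] at e
      exact reduce _ _ Set.inter_subset_left (Set.subset_inter hSU hS')
        (Set.subset_inter hTU hT') e
    · obtain ⟨x, hx, -⟩ := IsTwisted.exists_isStraight (i := i) (.corner j hij u hu hu')
      exact reduce _ _ le_rfl hSU hTU hx

/-! ### The twisted lattice and its linear sublattices -/

variable (K n) in
/-- The lattice of all twisted subspaces, ordered by inclusion. -/
def Twisted : Type _ := {S : Set (Space K n) // IsTwisted Set.univ S}

instance : PartialOrder (Twisted K n) :=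
  inferInstanceAs (PartialOrder {S : Set (Space K n) // IsTwisted Set.univ S})

theorem Twisted.le_iff {S T : Twisted K n} : S ≤ T ↔ S.1 ⊆ T.1 := Iff.rfl

section Lattice

variable [Finite K] [NeZero n]

instance : Finite (Twisted K n) :=
  inferInstanceAs (Finite {S : Set (Space K n) // IsTwisted Set.univ S})

variable [Fact (3 ≤ n)]

instance : Lattice (Twisted K n) where
  inf S T := ⟨S.1 ∩ T.1, S.2.inter Fact.out T.2⟩
  inf_le_left _ _ := Set.inter_subset_left
  inf_le_right _ _ := Set.inter_subset_right
  le_inf _ _ _ := Set.subset_inter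
  sup S T := ⟨⋂₀ {U | IsTwisted Set.univ U ∧ S.1 ∪ T.1 ⊆ U}, .sInter Fact.out _ fun _ h => h.1⟩
  le_sup_left _ _ := Set.subset_sInter fun _ h => Set.subset_union_left.trans h.2
  le_sup_right _ _ := Set.subset_sInter fun _ h => Set.subset_union_right.trans h.2
  sup_le _ _ U h h' := Set.sInter_subset_of_mem ⟨U.2, Set.union_subset h h'⟩

theorem Twisted.isTwisted_sup {i : ZMod n} {S T : Twisted K n} (hS : IsTwisted {i}ᶜ S.1)
    (hT : IsTwisted {i}ᶜ T.1) {y z : Submodule K (Space K n)} (hy : straighten i ⁻¹' S.1 = y)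
    (hz : straighten i ⁻¹' T.1 = z) :
    IsTwisted {i}ᶜ (S ⊔ T).1 ∧
      straighten i ⁻¹' (S ⊔ T).1 = (y ⊔ z : Submodule K (Space K n)) := by
  obtain ⟨y', hy', hys⟩ := hS.exists_isStraight
  obtain ⟨z', hz', hzs⟩ := hT.exists_isStraight
  obtain rfl : y = y' := SetLike.coe_injective (hy.symm.trans hy')
  obtain rfl : z = z' := SetLike.coe_injective (hz.symm.trans hz')
  have htw := (hys.sup Fact.out hzs).isTwisted
  have hsup : (S ⊔ T).1 =
      straighten i ⁻¹' ((y ⊔ z : Submodule K (Space K n)) : Set (Space K n)) := by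
    refine Set.Subset.antisymm ?_ ?_
    · have hle : S ⊔ T ≤ ⟨_, htw.mono (Set.subset_univ _)⟩ := by
        refine sup_le (Twisted.le_iff.mpr ?_) (Twisted.le_iff.mpr ?_)
        · rw [← straighten_preimage_preimage i S.1, hy]
          exact Set.preimage_mono (SetLike.coe_subset_coe.mpr le_sup_left)
        · rw [← straighten_preimage_preimage i T.1, hz]
          exact Set.preimage_mono (SetLike.coe_subset_coe.mpr le_sup_right)
      exact hle
    · exact straighten_sup_subset Fact.out hS hT (S ⊔ T).2 (le_sup_left : S ≤ S ⊔ T)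
        (le_sup_right : T ≤ S ⊔ T) hy hz
  rw [hsup]
  exact ⟨htw, straighten_preimage_preimage i _⟩

variable (K) in
/-- The twisted subspaces that do not use the index `i`, that is, those which arise without the side
and the corner at `i`. -/
def linearPart (i : ZMod n) : Sublattice (Twisted K n) where
  carrier := {S | IsTwisted {i}ᶜ S.1}
  supClosed' S hS T hT := by
    obtain ⟨y, hy, -⟩ := IsTwisted.exists_isStraight hS
    obtain ⟨z, hz, -⟩ := IsTwisted.exists_isStraight hT
    exact (Twisted.isTwisted_sup hS hT hy hz).1
  infClosed' _ hS _ hT := hS.inter Fact.out hT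

variable (K) in
/-- The representation of `linearPart i` by subspaces of `P × A`: take the image under the
involution `straighten i`, written as a preimage. -/
noncomputable def linearPartHom (i : ZMod n) :
    LatticeHom (linearPart K i) (Submodule K (Space K n)) where
  toFun S := (IsTwisted.exists_isStraight S.2).choose
  map_sup' S T := by
    refine SetLike.coe_injective ?_
    rw [← (IsTwisted.exists_isStraight (S ⊔ T).2).choose_spec.1]
    exact (Twisted.isTwisted_sup S.2 T.2 (IsTwisted.exists_isStraight S.2).choose_spec.1
      (IsTwisted.exists_isStraight T.2).choose_spec.1).2
  map_inf' S T := by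
    refine SetLike.coe_injective ?_
    rw [Submodule.coe_inf, ← (IsTwisted.exists_isStraight (S ⊓ T).2).choose_spec.1,
      ← (IsTwisted.exists_isStraight S.2).choose_spec.1,
      ← (IsTwisted.exists_isStraight T.2).choose_spec.1]
    rfl

theorem coe_linearPartHom (i : ZMod n) (S : linearPart K i) :
    (linearPartHom K i S : Set (Space K n)) = straighten i ⁻¹' S.1.1 :=
  (IsTwisted.exists_isStraight S.2).choose_spec.1.symm

theorem linearPartHom_injective (i : ZMod n) : Function.Injective (linearPartHom K i) := by
  intro S T h
  refine Subtype.ext (Subtype.ext ?_)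
  rw [← straighten_preimage_preimage i S.1.1, ← coe_linearPartHom, h, coe_linearPartHom,
    straighten_preimage_preimage]

/-- A single twisted subspace is missed by at most one of the sublattices `linearPart i`. -/
theorem exists_forall_mem_linearPart (S : Twisted K n) :
    ∃ j : ZMod n, ∀ i ≠ j, S ∈ linearPart K i := by
  obtain ⟨S, hS⟩ := S
  cases hS with
  | low y h => exact ⟨0, fun i _ => .low y h⟩
  | high y h => exact ⟨0, fun i _ => .high y h⟩
  | side j _ y h h' => exact ⟨j, fun i hi => .side j hi.symm y h h'⟩
  | corner j _ y h h' => exact ⟨j, fun i hi => .corner j hi.symm y h h'⟩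

/-- Fewer than `n` elements lie in a common sublattice `linearPart i`, so laws of subspace
lattices in fewer than `n` variables hold; `HigherArguesian m` has `2 * m` variables. -/
theorem higherArguesian_twisted {m : ℕ} (hm : 2 * m < n) : HigherArguesian m (Twisted K n) := by
  intro hm2 a b hne
  choose f hf using exists_forall_mem_linearPart (K := K) (n := n)
  classical
  obtain ⟨i, hi⟩ : ∃ i : ZMod n, i ∉ (Finset.Icc 1 m).image (fun k => f (a k)) ∪
      (Finset.Icc 1 m).image (fun k => f (b k)) := by
    by_contra! h
    have h1 := Finset.card_union_le ((Finset.Icc 1 m).image (fun k => f (a k)))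
      ((Finset.Icc 1 m).image (fun k => f (b k)))
    rw [Finset.eq_univ_iff_forall.mpr h, Finset.card_univ, ZMod.card] at h1
    have h2 := Finset.card_image_le (s := Finset.Icc 1 m) (f := fun k => f (a k))
    have h3 := Finset.card_image_le (s := Finset.Icc 1 m) (f := fun k => f (b k))
    rw [Nat.card_Icc] at h2 h3
    omega
  rw [Finset.mem_union, not_or] at hi
  refine HigherArguesian.of_mem_sublattice (linearPart K i)
    ((Submodule.higherArguesian m).of_injective _ (linearPartHom_injective i)) hm2 a b ?_ ?_ hne
  · intro k hk
    exact hf _ i fun h => hi.1 (Finset.mem_image.mpr ⟨k, hk, h.symm⟩)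
  · intro k hk
    exact hf _ i fun h => hi.2 (Finset.mem_image.mpr ⟨k, hk, h.symm⟩)

end Lattice

/-! ### Failure of the `n`-th law -/

section Elements

variable (K)

/-- The subspace of `wall j` given by `f j = f (j + 1) = c * α j`, where `α j` stands for the
coordinate belonging to `α j`. -/
def sideSubspace (c : K) (j : ZMod n) : Submodule K (Space K n) where
  carrier := {v | v ∈ wall K j ∧ v.1 j = c * v.2 j ∧ v.1 (j + 1) = c * v.2 j}
  add_mem' hv hw := ⟨add_mem hv.1 hw.1, by simp [hv.2.1, hw.2.1, mul_add],
    by simp [hv.2.2, hw.2.2, mul_add]⟩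
  zero_mem' := by simp
  smul_mem' r v hv := ⟨(wall K j).smul_mem r hv.1, by simp [hv.2.1, mul_left_comm],
    by simp [hv.2.2, mul_left_comm]⟩

/-- The subspace of `wedge j` given by `f j = c * α (j - 1) + d * α j`, where `α j` stands for the
coordinate belonging to `α j`. -/
def cornerSubspace (c d : K) (j : ZMod n) : Submodule K (Space K n) where
  carrier := {v | v ∈ wedge K j ∧ v.1 j = c * v.2 (j - 1) + d * v.2 j}
  add_mem' hv hw := ⟨add_mem hv.1 hw.1, by simp [hv.2, hw.2]; ring⟩
  zero_mem' := by simp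
  smul_mem' r v hv := ⟨(wedge K j).smul_mem r hv.1, by simp [hv.2]; ring⟩

/-- The twisted subspace `sideSubspace c j`. -/
def side (c : K) (j : ZMod n) : Twisted K n :=
  ⟨_, .side j (Set.mem_univ j) (sideSubspace K c j)
    (fun v hv => ⟨base_le_wall j (axis_le_base j hv), by simp [hv.1, hv.2.1],
      by simp [hv.1, hv.2.2]⟩) fun _ hv => hv.1⟩

/-- The twisted subspace corresponding to `cornerSubspace c d j` in the chart `flip j`. -/
def corner (c d : K) (j : ZMod n) : Twisted K n :=
  ⟨_, .corner j (Set.mem_univ j) (cornerSubspace K c d j)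
    (fun v hv => ⟨base_le_wedge j (hyper_le_base j hv), by simp [hv.1, hv.2]⟩) fun _ hv => hv.1⟩

/-- The linear functional on `A` with alternating coefficients `1, -1, 1, …` at the indices
`1, 2, …, n`. -/
def alternating [NeZero n] : (ZMod n → K) →ₗ[K] K :=
  ∑ k : ZMod n, (-1 : K) ^ (k - 1).val • LinearMap.proj k

/-- The twisted subspace `P + ker alternating`. -/
def top [NeZero n] : Twisted K n :=
  ⟨_, .high (LinearMap.ker (alternating K ∘ₗ LinearMap.snd K (ZMod n → K) (ZMod n → K)))
    fun v hv => by simp [mem_base.mp hv]⟩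

end Elements

theorem mem_side {c : K} {j : ZMod n} {v : Space K n} :
    v ∈ (side K c j).1 ↔ v ∈ wall K j ∧ v.1 j = c * v.2 j ∧ v.1 (j + 1) = c * v.2 j := Iff.rfl

theorem mem_corner_of_mem_wall {c d : K} {j : ZMod n} (hj : j - 1 ≠ j) {v : Space K n}
    (hv : v ∈ wall K j) : v ∈ (corner K c d j).1 ↔ v.1 j = -d * v.2 j := by
  change flip j v ∈ cornerSubspace K c d j ↔ _
  rw [flip_of_mem hv]
  have h : scale K (-1) v ∈ wedge K j :=
    (scale_mem_iff (base_le_wedge j) (neg_ne_zero.mpr one_ne_zero)).mpr (wall_le_wedge j hv)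
  refine (and_iff_right h).trans ?_
  simp [scale_apply, hv _ hj]

theorem mem_corner_of_notMem_wall {c d : K} {j : ZMod n} {v : Space K n} (hv : v ∉ wall K j) :
    v ∈ (corner K c d j).1 ↔ v ∈ wedge K j ∧ v.1 j = c * v.2 (j - 1) + d * v.2 j := by
  change flip j v ∈ cornerSubspace K c d j ↔ _
  rw [flip_of_notMem hv]
  rfl

theorem mem_wedge_of_mem_corner {c d : K} {j : ZMod n} {v : Space K n}
    (hv : v ∈ (corner K c d j).1) : v ∈ wedge K j :=
  (flip_mem_iff (base_le_wedge j)).mp (And.left hv)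

theorem pred_ne (hn : 3 ≤ n) (j : ZMod n) : j - 1 ≠ j := by
  intro e
  exact succ_ne_pred hn j (by linear_combination (-2 : ZMod n) * e)

theorem side_le_corner_succ (hn : 3 ≤ n) (c : K) (j : ZMod n) :
    side K c j ≤ corner K c (-c) (j + 1) := by
  refine Twisted.le_iff.mpr fun v hv => ?_
  obtain ⟨hw, -, h⟩ := mem_side.mp hv
  have hj := pred_ne hn (j + 1)
  have h0 : v.2 (j + 1) = 0 := hw _ (by simpa using hj.symm)
  by_cases hv' : v ∈ wall K (j + 1)
  · have : v.2 j = 0 := hv' _ (by simpa using hj)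
    rw [mem_corner_of_mem_wall hj hv', h, h0, this]
    simp
  · rw [mem_corner_of_notMem_wall hv', h0, h]
    exact ⟨wall_le_wedge_succ j hw, by simp⟩

theorem side_le_corner (hn : 3 ≤ n) (c : K) (j : ZMod n) :
    side K c j ≤ corner K c (-c) j := by
  refine Twisted.le_iff.mpr fun v hv => ?_
  obtain ⟨hw, h, -⟩ := mem_side.mp hv
  rw [mem_corner_of_mem_wall (pred_ne hn j) hw, h, neg_neg]

theorem alternating_of_mem_wedge [NeZero n] (hn : 3 ≤ n) {j : ZMod n} {v : Space K n}
    (hv : v ∈ wedge K j) : alternating K v.2 =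
      (-1) ^ (j - 1 - 1).val * v.2 (j - 1) + (-1) ^ (j - 1).val * v.2 j := by
  simp only [alternating, LinearMap.sum_apply, LinearMap.smul_apply, LinearMap.proj_apply,
    smul_eq_mul]
  refine Fintype.sum_eq_add _ _ (pred_ne hn j) fun k hk => ?_
  rw [hv k hk.1 hk.2, mul_zero]

theorem mem_top [NeZero n] {v : Space K n} : v ∈ (top K (n := n)).1 ↔ alternating K v.2 = 0 :=
  Iff.rfl

theorem side_zero_le_corner (hn : 3 ≤ n) (j : ZMod n) : side K 0 j ≤ corner K 2 0 j := by
  refine Twisted.le_iff.mpr fun v hv => ?_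
  obtain ⟨hw, h, -⟩ := mem_side.mp hv
  rw [mem_corner_of_mem_wall (pred_ne hn j) hw, h]
  simp

theorem sub_mem_of_mem_wall {S : Twisted K n} {j : ZMod n} {v w : Space K n} (hv : v ∈ S.1)
    (hw : w ∈ S.1) (hv' : v ∈ wall K j) (hw' : w ∈ wall K j) : v - w ∈ S.1 := by
  obtain ⟨x, hx⟩ := S.2.exists_inter_wall j
  have h1 : v ∈ x := SetLike.mem_coe.mp (hx ▸ ⟨hv, hv'⟩)
  have h2 : w ∈ x := SetLike.mem_coe.mp (hx ▸ ⟨hw, hw'⟩)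
  have : v - w ∈ (x : Set (Space K n)) := x.sub_mem h1 h2
  rw [← hx] at this
  exact this.1

variable [Finite K] [NeZero n] [Fact (3 ≤ n)]

theorem side_sup_side_le_corner (c : K) (j : ZMod n) :
    side K c j ⊔ side K c (j + 1) ≤ corner K c (-c) (j + 1) :=
  sup_le (side_le_corner_succ Fact.out c j) (side_le_corner Fact.out c (j + 1))

/-- The joins of `a j, a (j + 1)` and of `b j, b (j + 1)` meet, modulo `P`, in
`⟨α j + α (j + 1)⟩`, on which `alternating` vanishes as long as `n` is not passed. -/
theorem corner_inf_corner_le_top {m : ℕ} (hm : 1 ≤ m) (hmn : m < n) :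
    corner K 0 0 (m + 1 : ZMod n) ⊓ corner K 1 (-1) (m + 1 : ZMod n) ≤ top K := by
  have hn : 3 ≤ n := Fact.out
  refine Twisted.le_iff.mpr ?_
  rintro v ⟨h0, h1⟩
  have hw := mem_wedge_of_mem_corner h0
  have v1 : ((m + 1 : ZMod n) - 1).val = m := by
    rw [add_sub_cancel_right, ZMod.val_natCast_of_lt hmn]
  have v2 : ((m + 1 : ZMod n) - 1 - 1).val = m - 1 := by
    have : (m + 1 : ZMod n) - 1 - 1 = (m - 1 : ℕ) := by
      rw [Nat.cast_sub hm]
      push_cast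
      ring
    rw [this, ZMod.val_natCast_of_lt (by omega)]
  rw [mem_top, alternating_of_mem_wedge hn hw, v1, v2]
  by_cases hv : v ∈ wall K (m + 1 : ZMod n)
  · rw [mem_corner_of_mem_wall (pred_ne hn _) hv] at h0 h1
    have h2 : v.2 (m + 1) = 0 := by simpa [h0] using h1.symm
    rw [h2, hv _ (pred_ne hn _)]
    simp
  · rw [mem_corner_of_notMem_wall hv] at h0 h1
    have h2 : v.2 (m + 1 - 1) = v.2 (m + 1) := by
      have := h0.2.symm.trans h1.2
      linear_combination -this
    rw [h2, ← add_mul]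
    obtain ⟨k, rfl⟩ : ∃ k, m = k + 1 := ⟨m - 1, by omega⟩
    simp [pow_succ]

/-- At the closing index, `alternating` takes equal values on `α n` and `α 1` because `n` is odd;
this leaves the direction `α n - α 1` instead of `α n + α 1`. -/
theorem top_inf_corner_le (hodd : Odd n) :
    top K ⊓ corner K 1 (-1) (1 : ZMod n) ≤ corner K 2 0 1 := by
  have hn : 3 ≤ n := Fact.out
  refine Twisted.le_iff.mpr ?_
  rintro v ⟨h0, h1⟩
  have hw := mem_wedge_of_mem_corner h1
  have v1 : ((1 : ZMod n) - 1 - 1).val = n - 1 := by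
    have : (1 : ZMod n) - 1 - 1 = (n - 1 : ℕ) := by
      rw [Nat.cast_sub (by omega)]
      simp
    rw [this, ZMod.val_natCast_of_lt (by omega)]
  have he : Even (n - 1) := by
    obtain ⟨k, rfl⟩ := hodd
    exact ⟨k, by omega⟩
  rw [mem_top, alternating_of_mem_wedge hn hw, v1, he.neg_one_pow, sub_self, ZMod.val_zero,
    pow_zero, one_mul, one_mul] at h0
  by_cases hv : v ∈ wall K (1 : ZMod n)
  · rw [mem_corner_of_mem_wall (pred_ne hn _) hv] at h1 ⊢
    have h2 : v.2 0 = 0 := hv _ (by simpa using pred_ne hn (1 : ZMod n))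
    rw [h2, zero_add] at h0
    rw [h1, h0]
    simp
  · rw [mem_corner_of_notMem_wall hv] at h1 ⊢
    rw [sub_self] at h1 ⊢
    exact ⟨hw, by linear_combination h1.2 - h0⟩

/-- For odd `n`, the choice `a j = side 0 j`, `b j = side 1 j` violates the `n`-th law: the vector
`α n` lies in the left-hand side, but not in the twisted subspace `corner 2 0 1`, which contains
the right-hand side. -/
theorem not_higherArguesian_twisted (h2 : (2 : K) ≠ 0) (hodd : Odd n) :
    ¬ HigherArguesian n (Twisted K n) := by
  intro h
  have hn : 3 ≤ n := Fact.out
  have key := h (by omega) (fun i => side K 0 (i : ZMod n)) (fun i => side K 1 (i : ZMod n))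
  have hne : (Finset.Icc 1 (n - 1)).Nonempty := Finset.nonempty_Icc.mpr (by omega)
  simp only [ZMod.natCast_self, Nat.cast_one] at key
  have h01 : (0 : ZMod n) ≠ 1 := by simpa using pred_ne hn (1 : ZMod n)
  have bound : side K 0 (1 : ZMod n) ⊔ ((Finset.Icc 1 (n - 1)).sup' hne (fun i =>
      (side K 0 (i : ZMod n) ⊔ side K 0 ((i + 1 : ℕ) : ZMod n)) ⊓
        (side K 1 (i : ZMod n) ⊔ side K 1 ((i + 1 : ℕ) : ZMod n))) ⊓
      (side K 1 1 ⊔ side K 1 0)) ≤ corner K 2 0 1 := by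
    refine sup_le (side_zero_le_corner hn 1) (le_trans ?_ (top_inf_corner_le hodd))
    refine inf_le_inf (Finset.sup'_le _ _ fun i hi => ?_) ?_
    · have hi := Finset.mem_Icc.mp hi
      refine le_trans ?_ (corner_inf_corner_le_top hi.1 (by omega : i < n))
      push_cast
      refine inf_le_inf ?_ (side_sup_side_le_corner 1 _)
      simpa using side_sup_side_le_corner (K := K) 0 (i : ZMod n)
    · rw [sup_comm]
      simpa using side_sup_side_le_corner (K := K) 1 (0 : ZMod n)
  have single_mem : ∀ (j : ZMod n) (p : ZMod n → K),
      ((p, Pi.single j 1) : Space K n) ∈ wall K j := fun j p k hk => by simp [hk]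
  have mem_a : ∀ j : ZMod n, ((0, Pi.single j 1) : Space K n) ∈ (side K 0 j).1 :=
    fun j => mem_side.mpr ⟨single_mem j _, by simp, by simp⟩
  have mem_b : ∀ j : ZMod n, ((1, Pi.single j 1) : Space K n) ∈ (side K 1 j).1 :=
    fun j => mem_side.mpr ⟨single_mem j _, by simp, by simp⟩
  -- the vector `(1, 0)` lies in every `a j ⊔ b j`; it is passed on to the meet of these joins
  -- through the twisted subspace it spans
  have hd : Submodule.span K {((1, 0) : Space K n)} ≤ base K := by
    rw [Submodule.span_singleton_le_iff_mem]
    exact mem_base.mpr rfl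
  let d : Twisted K n := ⟨_, .low _ hd⟩
  have hdle : d ≤ (Finset.Icc 1 (n - 1)).inf' hne
      (fun i => side K 0 (i : ZMod n) ⊔ side K 1 (i : ZMod n)) := by
    refine Finset.le_inf' _ _ fun i _ => Twisted.le_iff.mpr fun v hv => ?_
    obtain ⟨c, rfl⟩ := Submodule.mem_span_singleton.mp hv
    set S := side K 0 (i : ZMod n) ⊔ side K 1 (i : ZMod n)
    have h1 := sub_mem_of_mem_wall (S := S)
      (Twisted.le_iff.mp (le_sup_right : _ ≤ S) (mem_b i))
      (Twisted.le_iff.mp (le_sup_left : _ ≤ S) (mem_a i)) (single_mem i _) (single_mem i _)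
    simp only [Prod.mk_sub_mk, sub_zero, sub_self] at h1
    obtain ⟨x, hx⟩ := S.2.exists_inter_base
    have h2 : ((1, 0) : Space K n) ∈ x := SetLike.mem_coe.mp (hx ▸ ⟨h1, mem_base.mpr rfl⟩)
    have h3 : c • ((1, 0) : Space K n) ∈ (x : Set (Space K n)) := x.smul_mem c h2
    rw [← hx] at h3
    exact h3.1
  have hmem : ((0, Pi.single 0 1) : Space K n) ∈ (corner K 2 0 (1 : ZMod n)).1 := by
    refine Twisted.le_iff.mp (key.trans bound) ⟨mem_a 0, ?_⟩
    set S := (Finset.Icc 1 (n - 1)).inf' hne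
      (fun i => side K 0 (i : ZMod n) ⊔ side K 1 (i : ZMod n))
    have h1 := sub_mem_of_mem_wall (S := S ⊔ side K 1 0) (j := 0)
      (Twisted.le_iff.mp (le_sup_right : _ ≤ S ⊔ side K 1 0) (mem_b 0))
      (Twisted.le_iff.mp (le_sup_left : S ≤ S ⊔ side K 1 0)
        (Twisted.le_iff.mp hdle (Submodule.mem_span_singleton_self _))) (single_mem 0 _)
      (base_le_wall 0 (mem_base.mpr rfl))
    simpa using h1
  have hnot : ((0, Pi.single 0 1) : Space K n) ∉ wall K 1 := fun hw => by
    simpa using hw 0 h01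
  rw [mem_corner_of_notMem_wall hnot] at hmem
  exact h2 (by simpa [h01.symm] using hmem.2.symm)

end TwistedPolygon

/-! ### Strictness -/

theorem mainTheorem1 :
    (∀ (L : Type u) [Lattice L], HigherArguesian 3 L ↔ Arguesian L) ∧
    ∀ m n : ℕ, 2 ≤ m → m < n →
      (∀ (L : Type u) [Lattice L],
        HigherArguesian (2 ^ n - 1) L → HigherArguesian (2 ^ m - 1) L) ∧
      ∃ (L : Type u) (_ : Lattice L), Finite L ∧
        HigherArguesian (2 ^ m - 1) L ∧ ¬ HigherArguesian (2 ^ n - 1) L := by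
  refine ⟨fun L _ => higherArguesian_three_iff_arguesian, fun m n hm hmn => ⟨fun L _ h => ?_, ?_⟩⟩
  · exact h.mono (Nat.sub_le_sub_right (Nat.pow_le_pow_right (by norm_num) hmn.le) 1)
  · have h4 : 2 ^ 2 ≤ 2 ^ m := Nat.pow_le_pow_right (by norm_num) hm
    have hpow : 2 * 2 ^ m ≤ 2 ^ n := by
      rw [← pow_succ']
      exact Nat.pow_le_pow_right (by norm_num) hmn
    have : Fact (3 ≤ 2 ^ n - 1) := ⟨by omega⟩
    have : NeZero (2 ^ n - 1) := ⟨by omega⟩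
    have h3 : (2 : ZMod 3) ≠ 0 := by decide
    have : Fact (Nat.Prime 3) := ⟨by norm_num⟩
    have h2 : (2 : ULift.{u} (ZMod 3)) ≠ 0 := fun h => by
      exact h3 (congrArg ULift.down h)
    have hodd : Odd (2 ^ n - 1) :=
      Nat.Even.sub_odd (by omega) ((Nat.even_pow.mpr ⟨even_two, by omega⟩)) odd_one
    exact ⟨TwistedPolygon.Twisted (ULift.{u} (ZMod 3)) (2 ^ n - 1), inferInstance, inferInstance,
      TwistedPolygon.higherArguesian_twisted (by omega),
      TwistedPolygon.not_higherArguesian_twisted h2 hodd⟩
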